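/- **Model.** A symbolic algorithm on $n$-vertex graphs knows the vertex set $V=\{0,\dots,n-1\}$ and can access the edge set $E$ of the input graph only through the one-step operations $\mathrm{Pre}(S)=\{v\in V\mid \exists s\in S:(v,s)\in E\}$ and $\mathrm{Post}(S)=\{v\in V\mid \exists s\in S:(s,v)\in E\}$, applied to sets $S\subseteq V$ that it chooses adaptively. The basic set operations $\cup,\cap,\setminus,\subseteq,=$, all other computation, and storage are unrestricted and free; only one-step operations are counted. A randomized symbolic algorithm is a random choice, according to some probability measure, of a deterministic one (such that on each graph the output and the number of one-step operations are random variables). For $c\ge 1$, a $c$-approximation of the diameter $D$ of a connected graph is a real number $\hat D$ with $D/c\le\hat D\le D$. **Theorem.** Any deterministic or bounded-error randomized symbolic algorithm that computes a $(3/2-\varepsilon)$-approximation of the diameter of an undirected connected graph with $n$ vertices needs $\Omega(n)$ symbolic one-step operations. Precisely: 1. There are a constant $\gamma>0$ and an $n_0$ such that for all $0<\varepsilon\le 1/2$, all $n\ge n_0$, and every deterministic symbolic algorithm that outputs a $(3/2-\varepsilon)$-approximation of the diameter on every undirected connected graph with $n$ vertices, there is an undirected connected graph with $n$ vertices on which the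 algorithm performs at least $\gamma n$ one-step operations. 2. For every $0\le\delta<1/2$ there are a constant $\gamma>0$ and an $n_0$ such that for all $0<\varepsilon\le 1/2$, all $n\ge n_0$, and every randomized symbolic algorithm that, on every undirected connected graph with $n$ vertices, outputs a $(3/2-\varepsilon)$-approximation of the diameter except with probability at most $\delta$, there is an undirected connected graph with $n$ vertices on which the expected number of one-step operations (hence also the maximum over the random choices) is at least $\gamma n$. -/

import Mathlib

/-! Symbolic graph algorithms: the input graph is accessible only through the one-step operations
`Pre` and `Post`, and the complexity measure is the number of one-step operations. -/

namespace SymbolicComputation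

/-- The predecessors of the vertices of `S` in the graph with edge relation `E`. -/
def preSet {V : Type*} (E : V → V → Prop) (S : Set V) : Set V :=
  {v | ∃ s ∈ S, E v s}

/-- The successors of the vertices of `S` in the graph with edge relation `E`. -/
def postSet {V : Type*} (E : V → V → Prop) (S : Set V) : Set V :=
  {v | ∃ s ∈ S, E s v}

/-- A deterministic symbolic algorithm on graphs with vertex set `V` and outputs in `α`, given by
its unfolding into the tree of all its possible executions. At each node the algorithm either
halts with an output, or performs a symbolic operation on sets of vertices of its choice; the
remaining algorithm is an arbitrary function of the result. The graph is no argument of the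
algorithm, so it is accessed through the one-step operations only. The vertex set is known, no
result is ever forgotten (arbitrarily many sets may be stored), and the non-symbolic computation
between two symbolic operations is unrestricted. -/
inductive Algorithm (V : Type*) (α : Type*) where
  /-- halt with the given output -/
  | halt (a : α)
  /-- the one-step operation `Pre` -/
  | pre (S : Set V) (next : Set V → Algorithm V α)
  /-- the one-step operation `Post` -/
  | post (S : Set V) (next : Set V → Algorithm V α)
  /-- the basic set operation `S ∪ T` -/
  | union (S T : Set V) (next : Set V → Algorithm V α)
  /-- the basic set operation `S ∩ T` -/
  | inter (S T : Set V) (next : Set V → Algorithm V α)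
  /-- the basic set operation `S \ T` -/
  | diff (S T : Set V) (next : Set V → Algorithm V α)
  /-- the test `S ⊆ T` -/
  | subset (S T : Set V) (yes no : Algorithm V α)
  /-- the test `S = T` -/
  | equal (S T : Set V) (yes no : Algorithm V α)

open Classical in
/-- The output of the algorithm on the graph with edge relation `E`. -/
noncomputable def Algorithm.output {V α : Type*} (E : V → V → Prop) : Algorithm V α → α
  | .halt a => a
  | .pre S next => (next (preSet E S)).output E
  | .post S next => (next (postSet E S)).output E
  | .union S T next => (next (S ∪ T)).output E
  | .inter S T next => (next (S ∩ T)).output E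
  | .diff S T next => (next (S \ T)).output E
  | .subset S T yes no => if S ⊆ T then yes.output E else no.output E
  | .equal S T yes no => if S = T then yes.output E else no.output E

open Classical in
/-- The number of one-step operations that the algorithm performs on the graph with edge
relation `E`. Basic set operations are not counted. -/
noncomputable def Algorithm.oneSteps {V α : Type*} (E : V → V → Prop) : Algorithm V α → ℕ
  | .halt _ => 0
  | .pre S next => (next (preSet E S)).oneSteps E + 1
  | .post S next => (next (postSet E S)).oneSteps E + 1
  | .union S T next => (next (S ∪ T)).oneSteps E
  | .inter S T next => (next (S ∩ T)).oneSteps E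
  | .diff S T next => (next (S \ T)).oneSteps E
  | .subset S T yes no => if S ⊆ T then yes.oneSteps E else no.oneSteps E
  | .equal S T yes no => if S = T then yes.oneSteps E else no.oneSteps E

/-- A randomized symbolic algorithm with real outputs, whose random choices form an element `ω` of
the space `Ω`: one deterministic algorithm for each `ω`, such that on each graph the output and
the number of one-step operations are random variables. -/
structure RandomizedAlgorithm (V : Type*) (Ω : Type*) [MeasurableSpace Ω] where
  /-- the algorithm that is executed when the random choices are `ω` -/
  alg : Ω → Algorithm V ℝ
  measurable_output : ∀ E : V → V → Prop, Measurable fun ω => (alg ω).output E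
  measurable_oneSteps : ∀ E : V → V → Prop, Measurable fun ω => (alg ω).oneSteps E

/-- `est` is an estimate of the number `D` within the factor `c`: `D / c ≤ est ≤ D`. -/
def IsEstimate (c : ℝ) (D : ℕ) (est : ℝ) : Prop :=
  (D : ℝ) / c ≤ est ∧ est ≤ (D : ℝ)

/-- The deterministic algorithm `A` computes a `c`-approximation of the diameter of every
undirected connected graph on the vertex set `V`. -/
def ApproximatesDiam {V : Type*} (c : ℝ) (A : Algorithm V ℝ) : Prop :=
  ∀ G : SimpleGraph V, G.Connected → IsEstimate c G.diam (A.output G.Adj)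

/-- On every undirected connected graph on the vertex set `V`, the randomized algorithm `A`, with
random choices distributed according to `P`, outputs a `c`-approximation of the diameter except
with probability at most `δ`. -/
def ApproximatesDiamWithError {V Ω : Type*} [MeasurableSpace Ω] (c δ : ℝ)
    (A : RandomizedAlgorithm V Ω) (P : MeasureTheory.Measure Ω) : Prop :=
  ∀ G : SimpleGraph V, G.Connected →
    P {ω | ¬ IsEstimate c G.diam ((A.alg ω).output G.Adj)} ≤ ENNReal.ofReal δ

end SymbolicComputation

/-! An adversary argument by counting edges. The hard graph is a clique, matched perfectly into a
middle layer that is joined completely to a third layer. Its diameter is at most 2, but deleting any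
single edge between the middle and third layers raises it to at least 3
(`three_le_diam_hardGraph_deleteEdges`), so a correct algorithm must answer differently
(`IsEstimate.ne`). With layers of linear size there are at least `n² / 18` such edges. One operation
is sensitive to at most `n` edge deletions: a vertex drops out of the result only if the deleted
edge was its sole edge to `S`, so the vertex determines the edge. Hence `q` operations detect at
most `n * q` deletions (`card_output_sensitive_le`), and `q ≥ n / 18`. For randomized algorithms the
detection probabilities are summed over the critical edges. -/

open MeasureTheory

namespace SymbolicComputation

/-! ### Sensitivity of symbolic algorithms to the deletion of one edge. -/

section Sensitivity

variable {V : Type*}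

lemma preSet_eq_postSet (G : SimpleGraph V) (S : Set V) :
    preSet G.Adj S = postSet G.Adj S := by
  ext v
  simp only [preSet, postSet, Set.mem_ofPred_eq, G.adj_comm]

open Classical in
/-- Only few edges are such that their deletion changes the result of a one-step operation. -/
lemma card_postSet_sensitive_le [Fintype V] (G : SimpleGraph V) (S : Set V) :
    (Finset.univ.filter fun e : Sym2 V =>
      postSet (G.deleteEdges {e}).Adj S ≠ postSet G.Adj S).card ≤ Fintype.card V := by
  -- Deletion can only shrink the result; a lost vertex `v` has `e` as its only edge to `S`, so `e ↦
  -- v` is injective.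
  have key : ∀ e : Sym2 V, postSet (G.deleteEdges {e}).Adj S ≠ postSet G.Adj S →
      ∃ v : V, v ∈ postSet G.Adj S ∧ ∀ u ∈ S, G.Adj u v → s(u, v) = e := by
    intro e he
    by_contra! hcon
    refine he (Set.Subset.antisymm ?_ ?_)
    · rintro v ⟨u, hu, h⟩
      exact ⟨u, hu, SimpleGraph.deleteEdges_le _ h⟩
    · intro v hv
      obtain ⟨u, hu, h, hne⟩ := hcon v hv
      exact ⟨u, hu, by simpa [SimpleGraph.deleteEdges_adj] using ⟨h, hne⟩⟩
  rcases isEmpty_or_nonempty V with hV | hV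
  · simp
  choose! f hf using key
  rw [← Finset.card_univ]
  refine Finset.card_le_card_of_injOn f (fun _ _ => Finset.mem_univ _) ?_
  intro e he e' he' hee
  obtain ⟨⟨u, hu, h⟩, h1⟩ := hf e (by simpa using he)
  have h2 := (hf e' (by simpa using he')).2
  rw [← hee] at h2
  exact (h1 u hu h).symm.trans (h2 u hu h)

open Classical in
/-- An algorithm with few one-step operations is sensitive to the deletion of few edges only. -/
lemma card_output_sensitive_le [Fintype V] {α : Type*} (G : SimpleGraph V)
    (A : Algorithm V α) :
    (Finset.univ.filter fun e : Sym2 V =>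
      A.output (G.deleteEdges {e}).Adj ≠ A.output G.Adj).card ≤
      Fintype.card V * A.oneSteps G.Adj := by
  have step : ∀ (S : Set V) (next : Set V → Algorithm V α),
      (Finset.univ.filter fun e : Sym2 V =>
        (next (postSet G.Adj S)).output (G.deleteEdges {e}).Adj ≠
          (next (postSet G.Adj S)).output G.Adj).card ≤
        Fintype.card V * (next (postSet G.Adj S)).oneSteps G.Adj →
      (Finset.univ.filter fun e : Sym2 V =>
        (next (postSet (G.deleteEdges {e}).Adj S)).output (G.deleteEdges {e}).Adj ≠
          (next (postSet G.Adj S)).output G.Adj).card ≤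
        Fintype.card V * ((next (postSet G.Adj S)).oneSteps G.Adj + 1) := by
    intro S next ih
    have hsub : (Finset.univ.filter fun e : Sym2 V =>
        (next (postSet (G.deleteEdges {e}).Adj S)).output (G.deleteEdges {e}).Adj ≠
          (next (postSet G.Adj S)).output G.Adj) ⊆
        (Finset.univ.filter fun e : Sym2 V =>
          (next (postSet G.Adj S)).output (G.deleteEdges {e}).Adj ≠
            (next (postSet G.Adj S)).output G.Adj) ∪
        (Finset.univ.filter fun e : Sym2 V =>
          postSet (G.deleteEdges {e}).Adj S ≠ postSet G.Adj S) := by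
      intro e he
      simp only [Finset.mem_union, Finset.mem_filter, Finset.mem_univ, true_and] at he ⊢
      -- With equal answers both runs continue in the same subtree, which is the one that `ih`
      -- covers.
      by_cases h : postSet (G.deleteEdges {e}).Adj S = postSet G.Adj S
      · rw [h] at he
        exact Or.inl he
      · exact Or.inr h
    rw [Nat.mul_add, mul_one]
    exact (Finset.card_le_card hsub).trans ((Finset.card_union_le _ _).trans
      (Nat.add_le_add ih (card_postSet_sensitive_le G S)))
  induction A with
  | halt a => simp [Algorithm.output]
  | pre S next ih =>
    simp only [Algorithm.output, Algorithm.oneSteps, preSet_eq_postSet]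
    exact step S next (ih _)
  | post S next ih =>
    simp only [Algorithm.output, Algorithm.oneSteps]
    exact step S next (ih _)
  | union S T next ih => exact ih _
  | inter S T next ih => exact ih _
  | diff S T next ih => exact ih _
  | subset S T yes no ihy ihn =>
    by_cases h : S ⊆ T
    · simpa only [Algorithm.output, Algorithm.oneSteps, if_pos h] using ihy
    · simpa only [Algorithm.output, Algorithm.oneSteps, if_neg h] using ihn
  | equal S T yes no ihy ihn =>
    by_cases h : S = T
    · simpa only [Algorithm.output, Algorithm.oneSteps, if_pos h] using ihy
    · simpa only [Algorithm.output, Algorithm.oneSteps, if_neg h] using ihn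

/-- A randomized algorithm that distinguishes a graph from many of its subgraphs with one edge
less, each with a probability of at least `p`, performs many one-step operations in expectation. -/
lemma card_mul_le_lintegral_oneSteps [Fintype V] {Ω ι : Type*} [Fintype ι] [MeasurableSpace Ω]
    (P : Measure Ω) (A : RandomizedAlgorithm V Ω) (G : SimpleGraph V) (e : ι → Sym2 V)
    (he : Function.Injective e) (p : ENNReal)
    (hp : ∀ i, p ≤ P {ω | (A.alg ω).output (G.deleteEdges {e i}).Adj ≠
      (A.alg ω).output G.Adj}) :
    (Fintype.card ι : ENNReal) * p ≤
      (Fintype.card V : ENNReal) * ∫⁻ ω, ((A.alg ω).oneSteps G.Adj : ENNReal) ∂P := by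
  classical
  have hmeas : ∀ i, MeasurableSet {ω | (A.alg ω).output (G.deleteEdges {e i}).Adj ≠
      (A.alg ω).output G.Adj} := fun i =>
    (measurableSet_eq_fun (A.measurable_output _) (A.measurable_output _)).compl
  calc (Fintype.card ι : ENNReal) * p = ∑ _i : ι, p := by simp
    _ ≤ ∑ i, P {ω | (A.alg ω).output (G.deleteEdges {e i}).Adj ≠ (A.alg ω).output G.Adj} :=
        Finset.sum_le_sum fun i _ => hp i
    -- The sum of the probabilities is the expected number of detected edges, which the
    -- deterministic bound controls for each `ω`.
    _ = ∫⁻ ω, ∑ i, Set.indicator {ω | (A.alg ω).output (G.deleteEdges {e i}).Adj ≠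
          (A.alg ω).output G.Adj} 1 ω ∂P := by
        rw [lintegral_finsetSum _ fun i _ => measurable_one.indicator (hmeas i)]
        exact Finset.sum_congr rfl fun i _ => (lintegral_indicator_one (hmeas i)).symm
    _ ≤ ∫⁻ ω, (Fintype.card V : ENNReal) * ((A.alg ω).oneSteps G.Adj : ENNReal) ∂P := by
        refine lintegral_mono fun ω => ?_
        have h : (Finset.univ.filter fun i => (A.alg ω).output (G.deleteEdges {e i}).Adj ≠
            (A.alg ω).output G.Adj).card ≤ Fintype.card V * (A.alg ω).oneSteps G.Adj :=
          (Finset.card_le_card_of_injOn e (fun i hi => by simpa using hi)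
            he.injOn).trans (card_output_sensitive_le G (A.alg ω))
        simp only [Set.indicator_apply, Set.mem_ofPred_eq, Pi.one_apply, Finset.sum_boole]
        exact_mod_cast h
    _ = _ := lintegral_const_mul' _ _ (ENNReal.natCast_ne_top _)

end Sensitivity

/-! ### Estimates that separate diameter 2 from diameter 3. -/

section Estimates

/-- The threshold is 2: `x ≤ D ≤ 2`, whereas `y ≥ 3 / (3 / 2 - ε) > 2` because `ε > 0`. -/
lemma IsEstimate.ne {ε : ℝ} (hε : 0 < ε) (hε' : ε ≤ 1 / 2) {D D' : ℕ} (hD : D ≤ 2)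
    (hD' : 3 ≤ D') {x y : ℝ} (hx : IsEstimate (3 / 2 - ε) D x)
    (hy : IsEstimate (3 / 2 - ε) D' y) : y ≠ x := by
  have h1 : x ≤ 2 := hx.2.trans (by exact_mod_cast hD)
  have h2 : (2 : ℝ) < D' / (3 / 2 - ε) := by
    rw [lt_div_iff₀ (by linarith)]
    have : (3 : ℝ) ≤ D' := by exact_mod_cast hD'
    linarith
  exact (h1.trans_lt (h2.trans_le hy.1)).ne'

/-- Union bound: the outputs differ unless the run on `G` or the run on `G'` errs. -/
lemma one_sub_le_measure_output_ne {V Ω : Type*} [MeasurableSpace Ω] {P : Measure Ω}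
    [IsProbabilityMeasure P] {A : RandomizedAlgorithm V Ω} {ε δ : ℝ} (hε : 0 < ε)
    (hε' : ε ≤ 1 / 2) (hδ : 0 ≤ δ) (hA : ApproximatesDiamWithError (3 / 2 - ε) δ A P)
    {G G' : SimpleGraph V} (hG : G.Connected) (hG' : G'.Connected) (hD : G.diam ≤ 2)
    (hD' : 3 ≤ G'.diam) :
    ENNReal.ofReal (1 - 2 * δ) ≤
      P {ω | (A.alg ω).output G'.Adj ≠ (A.alg ω).output G.Adj} := by
  have hcover : (Set.univ : Set Ω) ⊆
      ({ω | ¬ IsEstimate (3 / 2 - ε) G.diam ((A.alg ω).output G.Adj)} ∪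
        {ω | ¬ IsEstimate (3 / 2 - ε) G'.diam ((A.alg ω).output G'.Adj)}) ∪
      {ω | (A.alg ω).output G'.Adj ≠ (A.alg ω).output G.Adj} := by
    intro ω _
    by_cases h : IsEstimate (3 / 2 - ε) G.diam ((A.alg ω).output G.Adj)
    · by_cases h' : IsEstimate (3 / 2 - ε) G'.diam ((A.alg ω).output G'.Adj)
      · exact Or.inr (h.ne hε hε' hD hD' h')
      · exact Or.inl (Or.inr h')
    · exact Or.inl (Or.inl h)
  have h1 : (1 : ENNReal) ≤ ENNReal.ofReal (2 * δ) +
      P {ω | (A.alg ω).output G'.Adj ≠ (A.alg ω).output G.Adj} := by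
    rw [← measure_univ (μ := P), two_mul, ENNReal.ofReal_add hδ hδ]
    refine (measure_mono hcover).trans ((measure_union_le _ _).trans ?_)
    gcongr
    exact (measure_union_le _ _).trans (add_le_add (hA G hG) (hA G' hG'))
  rw [ENNReal.ofReal_sub _ (by positivity), ENNReal.ofReal_one]
  exact tsub_le_iff_left.2 h1

end Estimates

/-! ### The hard graph and its critical edges. -/

section HardGraph

/-- The graph consisting of a clique on the vertices below `k`, a perfect matching between these
and the vertices in `[k, 2 * k)`, and all edges between the latter and the vertices in
`[2 * k, n)`. -/
def hardGraph (n k : ℕ) : SimpleGraph (Fin n) :=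
  SimpleGraph.fromRel fun a b =>
    b.1 < k ∧ a.1 < k ∨ a.1 < k ∧ b.1 = a.1 + k ∨ k ≤ a.1 ∧ a.1 < 2 * k ∧ 2 * k ≤ b.1

variable {n k : ℕ}

lemma hardGraph_adj {a b : Fin n} : (hardGraph n k).Adj a b ↔
    a.1 ≠ b.1 ∧ ((b.1 < k ∧ a.1 < k ∨ a.1 < k ∧ b.1 = a.1 + k ∨
      k ≤ a.1 ∧ a.1 < 2 * k ∧ 2 * k ≤ b.1) ∨
      (a.1 < k ∧ b.1 < k ∨ b.1 < k ∧ a.1 = b.1 + k ∨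
      k ≤ b.1 ∧ b.1 < 2 * k ∧ 2 * k ≤ a.1)) := by
  simp only [hardGraph, SimpleGraph.fromRel_adj, ne_eq, Fin.ext_iff]

/-- The edges of `hardGraph n k` whose deletion increases the diameter. -/
def criticalEdge (hk : 2 * k ≤ n) (i : Fin (n - 2 * k) × Fin k) : Sym2 (Fin n) :=
  s(⟨2 * k + i.1.1, by omega⟩, ⟨k + i.2.1, by omega⟩)

lemma criticalEdge_injective (hk : 2 * k ≤ n) :
    Function.Injective (criticalEdge hk) := by
  rintro ⟨i, j⟩ ⟨i', j'⟩ h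
  simp only [criticalEdge, Sym2.eq_iff, Fin.mk.injEq] at h
  ext <;> simp only <;> omega

lemma exists_adj_adj_hardGraph (hk : 1 ≤ k) (hn : 2 * k < n) {u v : Fin n} (huv : u < v) :
    (hardGraph n k).Adj u v ∨ ∃ w, (hardGraph n k).Adj u w ∧ (hardGraph n k).Adj w v := by
  have huv' : u.1 < v.1 := huv
  by_cases hadj : (hardGraph n k).Adj u v
  · exact Or.inl hadj
  right
  rw [hardGraph_adj] at hadj
  simp only [hardGraph_adj]
  rcases lt_or_ge v.1 (2 * k) with hv | hv
  · rcases lt_or_ge u.1 k with hu | hu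
    · exact ⟨⟨v.1 - k, by omega⟩, by dsimp only; omega, by dsimp only; omega⟩
    · exact ⟨⟨2 * k, hn⟩, by dsimp only; omega, by dsimp only; omega⟩
  · rcases lt_or_ge u.1 k with hu | hu
    · exact ⟨⟨u.1 + k, by omega⟩, by dsimp only; omega, by dsimp only; omega⟩
    · exact ⟨⟨k, by omega⟩, by dsimp only; omega, by dsimp only; omega⟩

lemma exists_walk_hardGraph (hk : 1 ≤ k) (hn : 2 * k < n) (u v : Fin n) :
    ∃ p : (hardGraph n k).Walk u v, p.length ≤ 2 := by
  have key : ∀ u v : Fin n, u < v → ∃ p : (hardGraph n k).Walk u v, p.length ≤ 2 := by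
    intro u v huv
    rcases exists_adj_adj_hardGraph hk hn huv with h | ⟨w, h, h'⟩
    · exact ⟨h.toWalk, by simp⟩
    · exact ⟨.cons h h'.toWalk, by simp⟩
  rcases lt_trichotomy u v with h | rfl | h
  · exact key u v h
  · exact ⟨.nil, by simp⟩
  · obtain ⟨p, hp⟩ := key v u h
    exact ⟨p.reverse, by simpa using hp⟩

lemma hardGraph_connected (hk : 1 ≤ k) (hn : 2 * k < n) : (hardGraph n k).Connected where
  preconnected u v := ⟨(exists_walk_hardGraph hk hn u v).choose⟩
  nonempty := ⟨⟨2 * k, hn⟩⟩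

lemma diam_hardGraph_le (hk : 1 ≤ k) (hn : 2 * k < n) : (hardGraph n k).diam ≤ 2 := by
  have : Nonempty (Fin n) := ⟨⟨2 * k, hn⟩⟩
  obtain ⟨u, v, huv⟩ := (hardGraph n k).exists_dist_eq_diam
  obtain ⟨p, hp⟩ := exists_walk_hardGraph hk hn u v
  exact huv ▸ (SimpleGraph.dist_le p).trans hp

lemma deleteEdges_criticalEdge_adj (hk : 2 * k ≤ n) (i : Fin (n - 2 * k) × Fin k)
    {a b : Fin n} : ((hardGraph n k).deleteEdges {criticalEdge hk i}).Adj a b ↔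
      (hardGraph n k).Adj a b ∧ ¬ (a.1 = 2 * k + i.1 ∧ b.1 = k + i.2 ∨
        a.1 = k + i.2 ∧ b.1 = 2 * k + i.1) := by
  simp only [SimpleGraph.deleteEdges_adj, criticalEdge, Set.mem_singleton_iff, Sym2.eq_iff,
    Fin.ext_iff]

lemma hardGraph_deleteEdges_connected (hk : 2 ≤ k) (hn : 2 * k ≤ n)
    (i : Fin (n - 2 * k) × Fin k) :
    ((hardGraph n k).deleteEdges {criticalEdge hn i}).Connected := by
  set H := (hardGraph n k).deleteEdges {criticalEdge hn i} with hH
  have hadj : ∀ {a b : Fin n}, H.Adj a b ↔ _ := deleteEdges_criticalEdge_adj hn i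
  simp only [hardGraph_adj] at hadj
  let z : Fin n := ⟨0, by omega⟩
  have hP : ∀ u : Fin n, u.1 < k → H.Reachable u z := by
    intro u hu
    by_cases h0 : u = z
    · rw [h0]
    · have h0' : u.1 ≠ 0 := fun h => h0 (Fin.ext h)
      refine (hadj.2 ?_).reachable
      dsimp only [z]
      omega
  have hM : ∀ u : Fin n, u.1 < 2 * k → H.Reachable u z := by
    intro u hu
    rcases lt_or_ge u.1 k with h | h
    · exact hP u h
    · refine SimpleGraph.Reachable.trans (v := ⟨u.1 - k, by omega⟩)
        (hadj.2 ?_).reachable (hP _ (by dsimp only; omega))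
      dsimp only
      omega
  have hall : ∀ u : Fin n, H.Reachable u z := by
    intro u
    rcases lt_or_ge u.1 (2 * k) with h | h
    · exact hM u h
    · rcases Nat.eq_zero_or_pos i.2.1 with h0 | h0
      · refine SimpleGraph.Reachable.trans (v := ⟨k + 1, by omega⟩)
          (hadj.2 ?_).reachable (hM _ (by dsimp only; omega))
        dsimp only
        omega
      · refine SimpleGraph.Reachable.trans (v := ⟨k, by omega⟩)
          (hadj.2 ?_).reachable (hM _ (by dsimp only; omega))
        dsimp only
        omega
  exact { preconnected := fun u v => (hall u).trans (hall v).symm, nonempty := ⟨z⟩ }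

/-- The third-layer end `l` of the deleted edge is far from the clique vertex `p` matched to the
other end: that other end was their only common neighbour. -/
lemma three_le_diam_hardGraph_deleteEdges (hk : 2 ≤ k) (hn : 2 * k ≤ n)
    (i : Fin (n - 2 * k) × Fin k) :
    3 ≤ ((hardGraph n k).deleteEdges {criticalEdge hn i}).diam := by
  have hconn := hardGraph_deleteEdges_connected hk hn i
  set H := (hardGraph n k).deleteEdges {criticalEdge hn i} with hH
  have hadj : ∀ {a b : Fin n}, H.Adj a b ↔ _ := deleteEdges_criticalEdge_adj hn i
  simp only [hardGraph_adj] at hadj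
  let l : Fin n := ⟨2 * k + i.1.1, by omega⟩
  let p : Fin n := ⟨i.2.1, by omega⟩
  have := hconn.nonempty
  have hle : H.dist l p ≤ H.diam :=
    -- Connectedness excludes an infinite `ediam`, for which `diam` would be the default value 0.
    SimpleGraph.dist_le_diam (SimpleGraph.connected_iff_ediam_ne_top.1 hconn)
  refine le_trans ?_ hle
  obtain ⟨w, hw⟩ := hconn.exists_walk_length_eq_dist l p
  rw [← hw]
  by_contra! hlt
  have hl : l.1 = 2 * k + i.1.1 := rfl
  have hp : p.1 = i.2.1 := rfl
  -- The case split on the walk needs endpoints that are free variables; `hl` and `hp` keep their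
  -- values.
  clear_value l p
  match w, hlt with
  | .nil, _ => omega
  | .cons h .nil, _ =>
    rw [hadj] at h
    omega
  | .cons h (.cons h' .nil), _ =>
    rw [hadj] at h h'
    omega
  | .cons _ (.cons _ (.cons _ _)), hlt =>
    simp only [SimpleGraph.Walk.length_cons] at hlt
    omega

end HardGraph

/-- The deterministic algorithm `A` as a randomized one. -/
noncomputable def Algorithm.toRandomized {V : Type*} (Ω : Type*) [MeasurableSpace Ω]
    (A : Algorithm V ℝ) : RandomizedAlgorithm V Ω where
  alg _ := A
  measurable_output _ := measurable_const
  measurable_oneSteps _ := measurable_const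

/-- The lower bound on the expected number of one-step operations, with explicit constants. -/
lemma exists_le_lintegral_oneSteps {δ ε : ℝ} (hδ : 0 ≤ δ) (hδ' : δ < 1 / 2) (hε : 0 < ε)
    (hε' : ε ≤ 1 / 2) {n : ℕ} (hn : 6 ≤ n) {Ω : Type*} [MeasurableSpace Ω] (P : Measure Ω)
    [IsProbabilityMeasure P] (A : RandomizedAlgorithm (Fin n) Ω)
    (hA : ApproximatesDiamWithError (3 / 2 - ε) δ A P) :
    ∃ G : SimpleGraph (Fin n), G.Connected ∧
      ENNReal.ofReal ((1 - 2 * δ) / 18 * (n : ℝ)) ≤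
        ∫⁻ ω, ((A.alg ω).oneSteps G.Adj : ENNReal) ∂P := by
  -- Three layers of about equal size; `6 ≤ n` ensures `2 ≤ k`.
  obtain ⟨k, hk⟩ : ∃ k, k = n / 3 := ⟨_, rfl⟩
  have hk2 : 2 ≤ k := by omega
  have hkn : 2 * k < n := by omega
  have hconn := hardGraph_connected (by omega : 1 ≤ k) hkn
  refine ⟨hardGraph n k, hconn, ?_⟩
  have h := card_mul_le_lintegral_oneSteps P A (hardGraph n k) (criticalEdge hkn.le)
    (criticalEdge_injective hkn.le) (ENNReal.ofReal (1 - 2 * δ)) fun i =>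
      one_sub_le_measure_output_ne hε hε' hδ hA hconn
        (hardGraph_deleteEdges_connected hk2 hkn.le i) (diam_hardGraph_le (by omega) hkn)
        (three_le_diam_hardGraph_deleteEdges hk2 hkn.le i)
  simp only [Fintype.card_prod, Fintype.card_fin] at h
  have hn0 : (n : ENNReal) ≠ 0 := by
    exact_mod_cast (by omega : n ≠ 0)
  refine (ENNReal.mul_le_mul_iff_right hn0 (ENNReal.natCast_ne_top n)).1 (le_trans ?_ h)
  rw [← ENNReal.ofReal_natCast n, ← ENNReal.ofReal_natCast ((n - 2 * k) * k),
    ← ENNReal.ofReal_mul (by positivity), ← ENNReal.ofReal_mul (by positivity)]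
  refine ENNReal.ofReal_le_ofReal ?_
  -- Source of the constant 18: `n - 2 * k ≥ n / 3` and `k ≥ n / 6`.
  have hcard : n * n ≤ 18 * ((n - 2 * k) * k) := by
    have h1 : n ≤ 3 * (n - 2 * k) := by omega
    have h2 : n ≤ 6 * k := by omega
    calc n * n ≤ (3 * (n - 2 * k)) * (6 * k) := Nat.mul_le_mul h1 h2
      _ = 18 * ((n - 2 * k) * k) := by ring
  have hcard' : (n : ℝ) * n ≤ 18 * (((n - 2 * k) * k : ℕ) : ℝ) := by exact_mod_cast hcard
  nlinarith [mul_le_mul_of_nonneg_right hcard' (by linarith : (0 : ℝ) ≤ 1 - 2 * δ)]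

/-- The deterministic lower bound. -/
lemma exists_le_oneSteps {ε : ℝ} (hε : 0 < ε) (hε' : ε ≤ 1 / 2) {n : ℕ} (hn : 6 ≤ n)
    (A : Algorithm (Fin n) ℝ) (hA : ApproximatesDiam (3 / 2 - ε) A) :
    ∃ G : SimpleGraph (Fin n), G.Connected ∧ 1 / 18 * (n : ℝ) ≤ (A.oneSteps G.Adj : ℝ) := by
  -- A deterministic algorithm is a randomized one on a one-point space with `δ = 0`.
  obtain ⟨G, hG, h⟩ := exists_le_lintegral_oneSteps le_rfl (by norm_num : (0 : ℝ) < 1 / 2) hε hε' hn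
    (Measure.dirac ()) (A.toRandomized Unit) (by
      intro G hG
      simp [Algorithm.toRandomized, hA G hG])
  refine ⟨G, hG, ?_⟩
  simp only [Algorithm.toRandomized, lintegral_const, measure_univ, mul_one, mul_zero,
    sub_zero] at h
  rw [← ENNReal.ofReal_natCast] at h
  exact (ENNReal.ofReal_le_ofReal_iff (by positivity)).1 h

end SymbolicComputation

theorem theorem3p6 :
    -- deterministic algorithms
    (∃ c : ℝ, 0 < c ∧ ∃ n₀ : ℕ, ∀ ε : ℝ, 0 < ε → ε ≤ 1 / 2 → ∀ n : ℕ, n₀ ≤ n →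
      ∀ A : SymbolicComputation.Algorithm (Fin n) ℝ,
        SymbolicComputation.ApproximatesDiam (3 / 2 - ε) A →
        ∃ G : SimpleGraph (Fin n), G.Connected ∧ c * (n : ℝ) ≤ (A.oneSteps G.Adj : ℝ)) ∧
    -- randomized algorithms with error probability at most `δ < 1/2`, in expectation
    (∀ δ : ℝ, 0 ≤ δ → δ < 1 / 2 →
      ∃ c : ℝ, 0 < c ∧ ∃ n₀ : ℕ, ∀ ε : ℝ, 0 < ε → ε ≤ 1 / 2 → ∀ n : ℕ, n₀ ≤ n →
      ∀ (Ω : Type*) [MeasurableSpace Ω] (P : MeasureTheory.Measure Ω)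
        [MeasureTheory.IsProbabilityMeasure P]
        (A : SymbolicComputation.RandomizedAlgorithm (Fin n) Ω),
        SymbolicComputation.ApproximatesDiamWithError (3 / 2 - ε) δ A P →
        ∃ G : SimpleGraph (Fin n), G.Connected ∧
          ENNReal.ofReal (c * (n : ℝ)) ≤ ∫⁻ ω, ((A.alg ω).oneSteps G.Adj : ENNReal) ∂P) := by
  refine ⟨⟨1 / 18, by norm_num, 6, fun ε hε hε' n hn A hA =>
    SymbolicComputation.exists_le_oneSteps hε hε' hn A hA⟩, fun δ hδ hδ' => ?_⟩
  exact ⟨(1 - 2 * δ) / 18, by linarith, 6, fun ε hε hε' n hn Ω _ P _ A hA =>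
    SymbolicComputation.exists_le_lintegral_oneSteps hδ hδ' hε hε' hn P A hA⟩
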